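/- Let $N\ge 2$, $0<\ell<N$ and $1\le q<\infty$, and let $F,V,W$ be finite-dimensional complex normed spaces. Let $\nu$ be a positive Borel measure on $\mathbb R^N$ such that $$\|\nu\|_{0,(N-\ell)q}:=\sup_{r>0}\frac{\nu(B(0,r))}{r^{(N-\ell)q}}<\infty \qquad\text{and}\qquad [[\nu]]_{(N-\ell)q}:=\sup_{y\in\mathbb R^N}\int_0^{|y|/2}\frac{\nu(B(y,r))}{r^{(N-\ell)q+1}}\,dr<\infty .$$ Let $K:\mathbb R^N\times\mathbb R^N\to\mathcal L(F;W)$ be a locally integrable function (with respect to Lebesgue measure) that is measurable with respect to the completion of the product measure $\nu\otimes dy$ (for instance, Borel measurable), and suppose that for some constant $C$ $$|K(x,y)|\le C\,|x-y|^{\ell-N}\quad (x\ne y),\qquad |K(x,y)-K(x,0)|\le C\,\frac{|y|}{|x|^{N-\ell+1}}\quad (2|y|\le |x|).$$ Let $L(D)=\sum_{|\alpha|=\kappa}a_\alpha\partial^\alpha$, $a_\alpha\in\mathcal L(F;V)$, be a homogeneous linear differential operator of order $\kappa$ on $\mathbb R^N$ with constant coefficients from $F$ to $V$, with symbol $L(\xi)=\sum_{|\alpha|=\kappa}\xi^\alpha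 a_\alpha$, and assume that $L(D)$ is cocanceling, i.e. $\bigcap_{\xi\in\mathbb R^N\setminus\{0\}}\ker L(\xi)=\{0\}$. Then there is a constant $\widetilde C>0$ such that for every $g\in L^1(\mathbb R^N;F)$ with $L(D)g=0$ in the sense of distributions, the integral $\int_{\mathbb R^N}K(x,y)g(y)\,dy$ converges absolutely for $\nu$-almost every $x$, is a $\nu$-measurable function of $x$, and $$\left(\int_{\mathbb R^N}\left|\int_{\mathbb R^N}K(x,y)g(y)\,dy\right|^q d\nu(x)\right)^{1/q}\le \widetilde C\int_{\mathbb R^N}|g(x)|\,dx .$$ -/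

import Mathlib

open MeasureTheory
open scoped ENNReal ContDiff

/-- The partial derivative `∂ᵢ φ` on `ℝᴺ`. -/
noncomputable def partialDeriv {N : ℕ} (i : Fin N) (φ : EuclideanSpace ℝ (Fin N) → ℂ) :
    EuclideanSpace ℝ (Fin N) → ℂ :=
  fun x => fderiv ℝ φ x (EuclideanSpace.single i (1 : ℝ))

/-- The derivative `∂^α φ = ∂₁^{α₁} ⋯ ∂_N^{α_N} φ` for a multi-index `α`. -/
noncomputable def multiDeriv {N : ℕ} (α : Fin N → ℕ) (φ : EuclideanSpace ℝ (Fin N) → ℂ) :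
    EuclideanSpace ℝ (Fin N) → ℂ :=
  (List.finRange N).foldr (fun i ψ => (partialDeriv i)^[α i] ψ) φ

/-- The finite set of multi-indices `α ∈ ℕᴺ` with `|α| = κ`. -/
def multiIndices (N κ : ℕ) : Finset (Fin N → ℕ) :=
  Finset.piAntidiag Finset.univ κ

/-- A homogeneous linear differential operator `L(D) = ∑_{|α| = κ} a_α ∂^α` of order `κ` on `ℝᴺ`
with constant coefficients `a_α ∈ 𝓛(F; V)`. Only the coefficients with `|α| = κ` are ever used. -/
structure HomDiffOp (N κ : ℕ) (F V : Type*) [NormedAddCommGroup F] [NormedSpace ℂ F]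
    [NormedAddCommGroup V] [NormedSpace ℂ V] where
  /-- The coefficients `a_α`. -/
  coeff : (Fin N → ℕ) → (F →L[ℂ] V)

namespace HomDiffOp

variable {N κ : ℕ} {F V : Type*} [NormedAddCommGroup F] [NormedSpace ℂ F]
  [NormedAddCommGroup V] [NormedSpace ℂ V]

/-- The symbol `L(ξ) = ∑_{|α| = κ} ξ^α a_α`. -/
noncomputable def symbol (L : HomDiffOp N κ F V) (ξ : EuclideanSpace ℝ (Fin N)) : F →L[ℂ] V :=
  ∑ α ∈ multiIndices N κ, ((∏ i, ξ i ^ α i : ℝ) : ℂ) • L.coeff α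

/-- `L(D)` is cocanceling if the kernels of `L(ξ)`, `ξ ≠ 0`, have intersection `{0}`. -/
def Cocanceling (L : HomDiffOp N κ F V) : Prop :=
  (⋂ ξ ∈ {ξ : EuclideanSpace ℝ (Fin N) | ξ ≠ 0}, {e : F | L.symbol ξ e = 0}) = {0}

/-- `L(D) g = 0` in the sense of distributions on `ℝᴺ` (meaningful for locally integrable `g`):
`∑_{|α| = κ} (-1)^{|α|} ∫ ∂^α φ(y) a_α g(y) dy = 0` in `V` for every `φ ∈ C_c^∞(ℝᴺ)`. -/
def DistribKer (L : HomDiffOp N κ F V) (g : EuclideanSpace ℝ (Fin N) → F) : Prop :=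
  ∀ φ : EuclideanSpace ℝ (Fin N) → ℂ, ContDiff ℝ ∞ φ → HasCompactSupport φ →
    ∑ α ∈ multiIndices N κ, (-1 : ℂ) ^ κ • ∫ y, multiDeriv α φ y • L.coeff α (g y) = 0

end HomDiffOp

/-- `‖ν‖_{0,s} = sup_{r > 0} ν(B(0,r)) / r^s`. -/
noncomputable def centeredMorreyNorm {N : ℕ} (ν : Measure (EuclideanSpace ℝ (Fin N))) (s : ℝ) :
    ℝ≥0∞ :=
  ⨆ (r : ℝ) (_ : 0 < r), ν (Metric.ball 0 r) / ENNReal.ofReal (r ^ s)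

/-- `[[ν]]_s = sup_{y} ∫_0^{|y|/2} ν(B(y,r)) / r^{s+1} dr`. -/
noncomputable def uniformPotential {N : ℕ} (ν : Measure (EuclideanSpace ℝ (Fin N))) (s : ℝ) :
    ℝ≥0∞ :=
  ⨆ y : EuclideanSpace ℝ (Fin N),
    ∫⁻ r in Set.Ioo (0 : ℝ) (‖y‖ / 2), ν (Metric.ball y r) / ENNReal.ofReal (r ^ (s + 1))

/-! Put `a = N - ℓ` and split the `y`-integral at `|y| = |x|/4`. On the inner ball, write `K(x,y) =
K(x,0) + (K(x,y) - K(x,0))`. The difference is `O(|y| |x|^{-a-1})`, which gains decay in `x`. The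
frozen term is `K(x,0)` applied to the integral of `g` over `B(0,|x|/4)`, and this is where
cocancellation enters. Testing `L(D)g = 0` against a cutoff of `⟨ξ,y⟩^κ/κ!` bounds `L(ξ)` of that
integral by the mass of `g` in an annulus of radius about `|x|`; finitely many `ξ` determine a
vector of `F` (`Cocanceling.norm_integral_ball_le`). On the annulus `|x|^{-a}` is at most a constant
times `|x-y|^{-a}`, so everything is dominated by the integral of `steinWeissKernel a x y * ‖g y‖`
(`norm_integral_kernel_apply_le`).

It remains to map `L¹` to `L^q(ν)` by this positive kernel. Its slices in `x` are bounded in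
`L^q(ν)` uniformly in `y` (`exists_lintegral_steinWeissKernel_rpow_le`): the centered Morrey norm
handles `x` far from `y`, the potential handles the singularity at `y`. Hölder and Tonelli finish
(`lintegral_rpow_lintegral_le`). -/

/-! ### Iterated partial derivatives and their values on powers of a linear form. -/

section MultiDeriv

variable {N : ℕ}

local notation "𝔼" => EuclideanSpace ℝ (Fin N)

/-- Induction principle for comparing the iterated partial derivatives of two functions. -/
theorem multiDeriv_induction₂
    {P : (Fin N → ℕ) → (𝔼 → ℂ) → (𝔼 → ℂ) → Prop}
    (hP : ∀ i β φ ψ, P β φ ψ → P (Pi.single i 1 + β) (partialDeriv i φ) (partialDeriv i ψ))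
    {φ ψ : 𝔼 → ℂ} (h0 : P 0 φ ψ) (α : Fin N → ℕ) :
    P α (multiDeriv α φ) (multiDeriv α ψ) := by
  have iter : ∀ (i : Fin N) (n : ℕ) (β) (φ ψ : 𝔼 → ℂ), P β φ ψ →
      P (Pi.single i n + β) ((partialDeriv i)^[n] φ) ((partialDeriv i)^[n] ψ) := by
    intro i n β φ ψ h
    induction n with
    | zero => simpa using h
    | succ n ih =>
      rw [Function.iterate_succ_apply', Function.iterate_succ_apply']
      have := hP i _ _ _ ih
      rwa [← add_assoc, ← Pi.single_add, add_comm 1 n] at this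
  have key : ∀ l : List (Fin N), P (l.map fun i => Pi.single i (α i)).sum
      (l.foldr (fun i ψ => (partialDeriv i)^[α i] ψ) φ)
      (l.foldr (fun i ψ => (partialDeriv i)^[α i] ψ) ψ) := by
    intro l
    induction l with
    | nil => simpa using h0
    | cons i l ih => simpa using iter i (α i) _ _ _ ih
  have := key (List.finRange N)
  rwa [← List.ofFn_eq_map, List.sum_ofFn, Finset.univ_sum_single] at this

theorem multiDeriv_induction {P : (Fin N → ℕ) → (𝔼 → ℂ) → Prop}
    (hP : ∀ i β φ, P β φ → P (Pi.single i 1 + β) (partialDeriv i φ))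
    {φ : 𝔼 → ℂ} (h0 : P 0 φ) (α : Fin N → ℕ) : P α (multiDeriv α φ) :=
  multiDeriv_induction₂ (P := fun β φ _ => P β φ) (ψ := φ) (fun i β φ _ => hP i β φ) h0 α

theorem contDiff_multiDeriv {φ : 𝔼 → ℂ} (hφ : ContDiff ℝ ∞ φ) (α : Fin N → ℕ) :
    ContDiff ℝ ∞ (multiDeriv α φ) :=
  multiDeriv_induction (P := fun _ φ => ContDiff ℝ ∞ φ)
    (fun _ _ _ h => (h.fderiv_right (m := ∞) (by simp)).clm_apply contDiff_const) hφ α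

theorem multiDeriv_eq_zero_of_isOpen {φ : 𝔼 → ℂ} {U : Set 𝔼} (hU : IsOpen U)
    (hφ : ∀ y ∈ U, φ y = 0) (α : Fin N → ℕ) : ∀ y ∈ U, multiDeriv α φ y = 0 := by
  refine multiDeriv_induction (P := fun _ φ => ∀ y ∈ U, φ y = 0) (fun i _ φ h y hy => ?_) hφ α
  have : φ =ᶠ[nhds y] fun _ => 0 := Filter.eventually_of_mem (hU.mem_nhds hy) h
  simp [partialDeriv, this.fderiv_eq]

theorem multiDeriv_comp_smul (φ : 𝔼 → ℂ) (c : ℝ) (α : Fin N → ℕ) (y : 𝔼) :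
    multiDeriv α (fun y => φ (c • y)) y = (c : ℂ) ^ (∑ i, α i) * multiDeriv α φ (c • y) := by
  refine multiDeriv_induction₂ (P := fun β φ' φ => ∀ y, φ' y = (c : ℂ) ^ (∑ i, β i) * φ (c • y))
    (fun i β φ' φ h y => ?_) (by simp) α y
  obtain rfl : φ' = (c : ℂ) ^ (∑ i, β i) • fun y => φ (c • y) := funext h
  simp only [partialDeriv]
  rw [fderiv_const_smul_field, Pi.smul_apply, fderiv_comp_smul]
  simp [Finset.sum_add_distrib, pow_add]
  ring

/-- The normalized power `⟨ξ, y⟩ ^ k / k!`, as a complex valued function of `y`. -/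
noncomputable def innerPow (ξ : 𝔼) (k : ℕ) (y : 𝔼) : ℂ :=
  ((inner ℝ ξ y ^ k / k.factorial : ℝ) : ℂ)

theorem contDiff_innerPow (ξ : 𝔼) (k : ℕ) : ContDiff ℝ ∞ (innerPow ξ k) := by
  unfold innerPow
  refine Complex.ofRealCLM.contDiff.comp ?_
  exact ((contDiff_const.inner ℝ contDiff_id).pow k).div_const _

theorem partialDeriv_const_mul_innerPow (ξ : 𝔼) (k : ℕ) (c : ℂ) (i : Fin N) (y : 𝔼) :
    partialDeriv i (fun y => c * innerPow ξ (k + 1) y) y = c * ξ i * innerPow ξ k y := by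
  have h1 : HasFDerivAt (fun y : 𝔼 => inner ℝ ξ y) (innerSL ℝ ξ) y := (innerSL ℝ ξ).hasFDerivAt
  have h2 : HasDerivAt (fun t : ℝ => t ^ (k + 1) / (k + 1).factorial)
      (inner ℝ ξ y ^ k / k.factorial) (inner ℝ ξ y) := by
    have h := (hasDerivAt_pow (k + 1) (inner ℝ ξ y)).div_const ((k + 1).factorial : ℝ)
    refine h.congr_deriv ?_
    rw [Nat.factorial_succ]
    have := Nat.factorial_ne_zero k
    push_cast
    field_simp
  have h3 := ((Complex.ofRealCLM.hasFDerivAt.comp y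
    (h2.comp_hasFDerivAt y h1)).const_mul c).fderiv
  have h4 : (fun y => c * innerPow ξ (k + 1) y) = fun y => c *
    (Complex.ofRealCLM ∘ (fun t : ℝ => t ^ (k + 1) / (k + 1).factorial) ∘
      fun y : 𝔼 => inner ℝ ξ y) y := rfl
  rw [partialDeriv, h4, h3]
  simp [innerPow, EuclideanSpace.inner_single_right]
  ring

/-- On an open set where `φ` agrees with `⟨ξ, y⟩ ^ κ / κ!`, the derivatives of order `κ` of `φ` are
the monomials `ξ ^ α`. -/
theorem multiDeriv_eq_of_eqOn_innerPow {φ : 𝔼 → ℂ} {U : Set 𝔼} (hU : IsOpen U) (ξ : 𝔼) {κ : ℕ}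
    (hφ : ∀ y ∈ U, φ y = innerPow ξ κ y) {α : Fin N → ℕ} (hα : ∑ i, α i = κ) :
    ∀ y ∈ U, multiDeriv α φ y = ((∏ i, ξ i ^ α i : ℝ) : ℂ) := by
  have := multiDeriv_induction (P := fun β φ => ∑ i, β i ≤ κ → ∀ y ∈ U,
    φ y = ((∏ i, ξ i ^ β i : ℝ) : ℂ) * innerPow ξ (κ - ∑ i, β i) y) (φ := φ)
    (fun i β φ h hβ y hy => ?_) (by simpa using hφ) α hα.le
  · intro y hy
    rw [this y hy, hα]
    simp [innerPow]
  · simp only [Pi.add_apply, Finset.sum_add_distrib, Finset.sum_pi_single', Finset.mem_univ,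
      if_true] at hβ
    have e : φ =ᶠ[nhds y] fun y => ((∏ i, ξ i ^ β i : ℝ) : ℂ) * innerPow ξ (κ - ∑ i, β i) y :=
      Filter.eventually_of_mem (hU.mem_nhds hy) (h (by omega))
    obtain ⟨k, hk⟩ : ∃ k, κ - ∑ i, β i = k + 1 := ⟨κ - ∑ i, β i - 1, by omega⟩
    have hk' : κ - ∑ j, (Pi.single i 1 + β : Fin N → ℕ) j = k := by
      simp only [Pi.add_apply, Finset.sum_add_distrib, Finset.sum_pi_single', Finset.mem_univ,
        if_true]
      omega
    rw [hk', partialDeriv, e.fderiv_eq, hk]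
    refine (partialDeriv_const_mul_innerPow ξ k _ i y).trans ?_
    have e1 : ∏ j, ξ j ^ (Pi.single i 1 : Fin N → ℕ) j = ξ i := by
      rw [Finset.prod_eq_single i (fun j _ hj => by simp [hj]) (by simp)]
      simp
    simp only [Pi.add_apply, pow_add, Finset.prod_mul_distrib, e1]
    push_cast
    ring

end MultiDeriv

/-! ### Cocancellation: integrals over balls are controlled by annuli. -/

section Cocanceling

variable {N κ : ℕ} {F V : Type*} [NormedAddCommGroup F] [NormedSpace ℂ F]
  [NormedAddCommGroup V] [NormedSpace ℂ V]

local notation "𝔼" => EuclideanSpace ℝ (Fin N)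

/-- A compactly supported smooth function equal to `⟨ξ, y⟩ ^ k / k!` near the origin. -/
theorem exists_cutoff_innerPow (ξ : 𝔼) (k : ℕ) :
    ∃ m : 𝔼 → ℂ, ContDiff ℝ ∞ m ∧ (∀ y ∈ Metric.ball (0 : 𝔼) (1 / 4), m y = innerPow ξ k y) ∧
      ∀ y : 𝔼, 1 / 2 < ‖y‖ → m y = 0 := by
  let f : ContDiffBump (0 : 𝔼) := ⟨1 / 4, 1 / 2, by norm_num, by norm_num⟩
  refine ⟨fun y => (f y : ℂ) * innerPow ξ k y, ?_, fun y hy => ?_, fun y hy => ?_⟩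
  · exact (Complex.ofRealCLM.contDiff.comp f.contDiff).mul (contDiff_innerPow ξ k)
  · beta_reduce
    rw [f.one_of_mem_closedBall (Metric.ball_subset_closedBall hy)]
    simp
  · beta_reduce
    rw [f.zero_of_le_dist (by simpa [f] using hy.le)]
    simp

theorem hasCompactSupport_of_norm_lt {φ : 𝔼 → ℂ} {R : ℝ} (h : ∀ y, R < ‖y‖ → φ y = 0) :
    HasCompactSupport φ :=
  HasCompactSupport.intro (isCompact_closedBall (0 : 𝔼) R) fun y hy => h y (by simpa using hy)

theorem exists_bound_of_norm_lt {φ : 𝔼 → ℂ} {R : ℝ} (hφ : Continuous φ)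
    (h : ∀ y, R < ‖y‖ → φ y = 0) : ∃ M : ℝ, 0 ≤ M ∧ ∀ y, ‖φ y‖ ≤ M := by
  obtain ⟨M, hM⟩ := hφ.bounded_above_of_compact_support (hasCompactSupport_of_norm_lt h)
  exact ⟨M, (norm_nonneg _).trans (hM 0), hM⟩

/-- The annulus `R / 4 ≤ |y| ≤ R / 2`. -/
def annulus (N : ℕ) (R : ℝ) : Set (EuclideanSpace ℝ (Fin N)) :=
  {y | R / 4 ≤ ‖y‖ ∧ ‖y‖ ≤ R / 2}

theorem measurableSet_annulus (R : ℝ) : MeasurableSet (annulus N R) :=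
  (measurableSet_le measurable_const measurable_norm).inter
    (measurableSet_le measurable_norm measurable_const)

namespace HomDiffOp

/-- Test with `m(y/R)`, where `m` cuts off `⟨ξ,y⟩^κ/κ!`. On the ball of radius `R/4` the order-`κ`
derivatives of `m` are the monomials `ξ^α`, which reassemble the symbol; beyond `R/2` they vanish.
Only the annulus is left. -/
theorem norm_symbol_integral_ball_le [FiniteDimensional ℂ F] [FiniteDimensional ℂ V]
    (L : HomDiffOp N κ F V) (ξ : 𝔼) :
    ∃ M : ℝ, 0 ≤ M ∧ ∀ g : 𝔼 → F, Integrable g volume → L.DistribKer g → ∀ R : ℝ, 0 < R →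
      ‖L.symbol ξ (∫ y in Metric.ball 0 (R / 4), g y)‖ ≤ M * ∫ y in annulus N R, ‖g y‖ := by
  have : CompleteSpace F := FiniteDimensional.complete ℂ F
  have : CompleteSpace V := FiniteDimensional.complete ℂ V
  obtain ⟨m, hm, hm1, hm0⟩ := exists_cutoff_innerPow ξ κ
  have hopen : IsOpen {y : 𝔼 | 1 / 2 < ‖y‖} := isOpen_lt continuous_const continuous_norm
  have hD0 := fun α => multiDeriv_eq_zero_of_isOpen hopen hm0 α
  have hD1 : ∀ α ∈ multiIndices N κ, ∀ y ∈ Metric.ball (0 : 𝔼) (1 / 4),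
      multiDeriv α m y = ((∏ i, ξ i ^ α i : ℝ) : ℂ) := fun α hα =>
    multiDeriv_eq_of_eqOn_innerPow Metric.isOpen_ball ξ hm1 (by simpa [multiIndices] using hα)
  choose M hM0 hM using fun α =>
    exists_bound_of_norm_lt (contDiff_multiDeriv hm α).continuous (hD0 α)
  refine ⟨∑ α ∈ multiIndices N κ, M α * ‖L.coeff α‖,
    Finset.sum_nonneg fun α _ => mul_nonneg (hM0 α) (norm_nonneg _), fun g hg hLg R hR => ?_⟩
  have hnorm : ∀ y : 𝔼, ‖R⁻¹ • y‖ = ‖y‖ / R := fun y => by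
    rw [norm_smul, norm_inv, Real.norm_of_nonneg hR.le, inv_mul_eq_div]
  have hint : ∀ α, Integrable (fun y => multiDeriv α m (R⁻¹ • y) • L.coeff α (g y)) volume := by
    intro α
    refine ((L.coeff α).integrable_comp hg).bdd_smul (M α) ?_ ?_
    · exact ((contDiff_multiDeriv hm α).continuous.comp
        (continuous_const_smul _)).aestronglyMeasurable
    · exact Filter.Eventually.of_forall fun y => hM α _
  -- By homogeneity every term carries the same nonzero factor `R^{-κ}`, which cancels; hence `M`
  -- does not depend on `R`.
  have key : ∑ α ∈ multiIndices N κ, ∫ y, multiDeriv α m (R⁻¹ • y) • L.coeff α (g y) = 0 := by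
    have h := hLg (fun y => m (R⁻¹ • y)) (hm.comp (contDiff_const_smul _))
      (hasCompactSupport_of_norm_lt (R := R / 2) fun y hy => hm0 _ (by
        rw [hnorm, lt_div_iff₀ hR]; linarith))
    have h2 : ∀ α ∈ multiIndices N κ,
        ∫ y, multiDeriv α (fun y => m (R⁻¹ • y)) y • L.coeff α (g y) =
          ((R⁻¹ : ℝ) : ℂ) ^ κ • ∫ y, multiDeriv α m (R⁻¹ • y) • L.coeff α (g y) := by
      intro α hα
      rw [← integral_smul]
      congr 1 with y
      rw [multiDeriv_comp_smul, smul_smul, (by simpa [multiIndices] using hα : ∑ i, α i = κ)]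
    rw [Finset.sum_congr rfl fun α hα => by rw [h2 α hα], ← Finset.smul_sum,
      ← Finset.smul_sum] at h
    simpa [hR.ne'] using h
  set B : Set 𝔼 := Metric.ball 0 (R / 4)
  have hB : MeasurableSet B := Metric.isOpen_ball.measurableSet
  have hin : ∀ α ∈ multiIndices N κ,
      ∫ y in B, multiDeriv α m (R⁻¹ • y) • L.coeff α (g y) =
        ((∏ i, ξ i ^ α i : ℝ) : ℂ) • L.coeff α (∫ y in B, g y) := by
    intro α hα
    rw [← (L.coeff α).integral_comp_comm hg.integrableOn, ← integral_smul]
    refine setIntegral_congr_fun hB fun y hy => ?_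
    simp only
    rw [hD1 α hα _ ?_]
    have hy' : ‖y‖ < R / 4 := by simpa [B] using hy
    rw [mem_ball_zero_iff, hnorm, div_lt_iff₀ hR]
    linarith
  have hout : ∀ α, ‖∫ y in Bᶜ, multiDeriv α m (R⁻¹ • y) • L.coeff α (g y)‖ ≤
      M α * ‖L.coeff α‖ * ∫ y in annulus N R, ‖g y‖ := by
    intro α
    rw [← integral_const_mul, ← integral_indicator hB.compl,
      ← integral_indicator (measurableSet_annulus R)]
    refine norm_integral_le_of_norm_le
      ((hg.norm.const_mul _).indicator (measurableSet_annulus R))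
      (Filter.Eventually.of_forall fun y => ?_)
    by_cases hy : y ∈ annulus N R
    · rw [Set.indicator_of_mem hy]
      refine (norm_indicator_le_norm_self _ _).trans ?_
      rw [norm_smul, mul_assoc]
      exact mul_le_mul (hM α _) ((L.coeff α).le_opNorm _) (norm_nonneg _) (hM0 α)
    · rw [Set.indicator_of_notMem hy]
      refine (norm_le_zero_iff.2 ?_)
      by_cases hyB : y ∈ Bᶜ
      · rw [Set.indicator_of_mem hyB, hD0 α _ ?_, zero_smul]
        have h1 : R / 4 ≤ ‖y‖ := by simpa [B] using hyB
        have h2 : R / 2 < ‖y‖ := by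
          by_contra h
          exact hy ⟨h1, not_lt.1 h⟩
        rw [Set.mem_ofPred_eq, hnorm, lt_div_iff₀ hR]
        linarith
      · rw [Set.indicator_of_notMem hyB]
  have hsum : L.symbol ξ (∫ y in B, g y) =
      -∑ α ∈ multiIndices N κ, ∫ y in Bᶜ, multiDeriv α m (R⁻¹ • y) • L.coeff α (g y) := by
    rw [eq_neg_iff_add_eq_zero, ← key, symbol, sum_apply,
      ← Finset.sum_add_distrib]
    refine Finset.sum_congr rfl fun α hα => ?_
    rw [smul_apply, ← hin α hα, integral_add_compl hB (hint α)]
  rw [hsum, norm_neg, Finset.sum_mul]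
  exact (norm_sum_le _ _).trans (Finset.sum_le_sum fun α _ => hout α)

/-- Among intersections of finitely many kernels choose a minimal one, by finite dimension of `F`.
Adjoining any further `ξ` cannot shrink it, so it already lies in every kernel. -/
theorem Cocanceling.exists_finset [FiniteDimensional ℂ F] {L : HomDiffOp N κ F V}
    (hL : L.Cocanceling) : ∃ s : Finset 𝔼, ∀ e : F, (∀ ξ ∈ s, L.symbol ξ e = 0) → e = 0 := by
  let W : Finset 𝔼 → Submodule ℂ F := fun s => ⨅ ξ ∈ s, LinearMap.ker (L.symbol ξ).toLinearMap
  have hW : ∀ s e, e ∈ W s ↔ ∀ ξ ∈ s, L.symbol ξ e = 0 := fun s e => by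
    simp [W, Submodule.mem_iInf]
  obtain ⟨_, ⟨s, rfl⟩, hs⟩ := wellFounded_lt.has_min (Set.range W) ⟨_, ∅, rfl⟩
  refine ⟨s, fun e he => ?_⟩
  have hmem : e ∈ (⋂ ξ ∈ {ξ : 𝔼 | ξ ≠ 0}, {e : F | L.symbol ξ e = 0}) := by
    classical
    simp only [Set.mem_iInter]
    intro ξ _
    have hle : W (insert ξ s) ≤ W s := fun x hx =>
      (hW _ _).2 fun η hη => (hW _ _).1 hx η (Finset.mem_insert_of_mem hη)
    have heq : W (insert ξ s) = W s := by
      by_contra h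
      exact hs _ ⟨_, rfl⟩ (lt_of_le_of_ne hle h)
    exact (hW _ _).1 (heq ▸ (hW s e).2 he) ξ (Finset.mem_insert_self _ _)
  have hL' := hL
  rw [Cocanceling] at hL'
  rw [hL'] at hmem
  exact hmem

theorem Cocanceling.norm_integral_ball_le [FiniteDimensional ℂ F] [FiniteDimensional ℂ V]
    {L : HomDiffOp N κ F V} (hL : L.Cocanceling) :
    ∃ M : ℝ, 0 ≤ M ∧ ∀ g : 𝔼 → F, Integrable g volume → L.DistribKer g → ∀ R : ℝ, 0 < R →
      ‖∫ y in Metric.ball 0 (R / 4), g y‖ ≤ M * ∫ y in annulus N R, ‖g y‖ := by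
  obtain ⟨s, hs⟩ := hL.exists_finset
  let T : F →ₗ[ℂ] (s → V) := LinearMap.pi fun ξ => (L.symbol ξ).toLinearMap
  have hT : LinearMap.ker T = ⊥ := by
    refine LinearMap.ker_eq_bot'.2 fun e he => hs e fun ξ hξ => ?_
    exact congrFun he ⟨ξ, hξ⟩
  -- An injective linear map on a finite-dimensional space is bounded below, so `‖e‖` is controlled
  -- by the finitely many `‖L(ξ)e‖`.
  obtain ⟨c, -, hc⟩ := T.exists_antilipschitzWith hT
  choose M hM0 hM using fun ξ => L.norm_symbol_integral_ball_le ξ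
  have hS : 0 ≤ ∑ ξ : s, M ξ := Finset.sum_nonneg fun ξ _ => hM0 ξ
  refine ⟨c * ∑ ξ : s, M ξ, mul_nonneg c.2 hS,
    fun g hg hLg R hR => ?_⟩
  have h0 : 0 ≤ ∫ y in annulus N R, ‖g y‖ := integral_nonneg fun y => norm_nonneg _
  have h1 := hc.le_mul_norm (map_zero T) (∫ y in Metric.ball 0 (R / 4), g y)
  refine h1.trans ?_
  rw [mul_assoc]
  refine mul_le_mul_of_nonneg_left ?_ c.2
  rw [pi_norm_le_iff_of_nonneg (mul_nonneg hS h0)]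
  intro ξ
  refine (hM ξ g hg hLg R hR).trans (mul_le_mul_of_nonneg_right ?_ h0)
  exact Finset.single_le_sum (f := fun ξ : s => M ξ) (fun ξ _ => hM0 ξ) (Finset.mem_univ ξ)

end HomDiffOp

end Cocanceling

/-! ### Power weights integrated against `ν`. -/

section Potential

variable {N : ℕ}

local notation "𝔼" => EuclideanSpace ℝ (Fin N)

/-- On an interval of length `t` the integrand is at least `(2t)^{-p-1}`. Using only `(t, 2t)`
rather than `(t, ∞)` keeps the radii local, as the truncated potential requires. -/
theorem ofReal_rpow_neg_le_lintegral_Ioo {t p : ℝ} (ht : 0 ≤ t) (hp : 0 < p) :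
    ENNReal.ofReal (t ^ (-p)) ≤ ENNReal.ofReal (2 ^ (p + 1)) *
      ∫⁻ r in Set.Ioo t (2 * t), (ENNReal.ofReal (r ^ (p + 1)))⁻¹ := by
  rcases ht.eq_or_lt with rfl | ht
  -- At `t = 0` the real power `0 ^ (-p)` is `0` by convention.
  · simp [Real.zero_rpow (neg_ne_zero.2 hp.ne')]
  have h2 : 0 < 2 * t := by positivity
  calc ENNReal.ofReal (t ^ (-p))
      = ENNReal.ofReal (2 ^ (p + 1)) * ((ENNReal.ofReal ((2 * t) ^ (p + 1)))⁻¹ *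
          volume (Set.Ioo t (2 * t))) := by
        rw [Real.volume_Ioo, ← ENNReal.ofReal_inv_of_pos (Real.rpow_pos_of_pos h2 _),
          ← ENNReal.ofReal_mul (by positivity), ← ENNReal.ofReal_mul (by positivity),
          Real.mul_rpow two_pos.le ht.le, Real.rpow_neg ht.le, Real.rpow_add_one ht.ne']
        congr 1
        have := Real.rpow_pos_of_pos ht p
        have h3 := Real.rpow_pos_of_pos two_pos (p + 1)
        field_simp
        ring
    _ = ENNReal.ofReal (2 ^ (p + 1)) *
          ∫⁻ r in Set.Ioo t (2 * t), (ENNReal.ofReal ((2 * t) ^ (p + 1)))⁻¹ := by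
        rw [setLIntegral_const]
    _ ≤ _ := by
        refine mul_le_mul_right (setLIntegral_mono' measurableSet_Ioo fun r hr => ?_) _
        refine ENNReal.inv_le_inv.2 (ENNReal.ofReal_le_ofReal ?_)
        exact Real.rpow_le_rpow (ht.trans hr.1).le hr.2.le (by linarith)

/-- A power singularity is controlled by the averages of `ν` over balls. -/
theorem setLIntegral_rpow_neg_le (ν : Measure 𝔼) [SFinite ν] (y : 𝔼) {p : ℝ} (hp : 0 < p)
    {S : Set 𝔼} (hS : MeasurableSet S) {I : Set ℝ} (hI : MeasurableSet I)
    (hSI : ∀ x ∈ S, Set.Ioo ‖x - y‖ (2 * ‖x - y‖) ⊆ I) :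
    ∫⁻ x in S, ENNReal.ofReal (‖x - y‖ ^ (-p)) ∂ν ≤ ENNReal.ofReal (2 ^ (p + 1)) *
      ∫⁻ r in I, ν (Metric.ball y r) / ENNReal.ofReal (r ^ (p + 1)) := by
  let f : 𝔼 → ℝ → ℝ≥0∞ := fun x r =>
    {z : 𝔼 × ℝ | ‖z.1 - y‖ < z.2}.indicator (fun z => (ENNReal.ofReal (z.2 ^ (p + 1)))⁻¹) (x, r)
  have hf : Measurable (Function.uncurry f) := by
    refine Measurable.indicator (by fun_prop) ?_
    exact measurableSet_lt (by fun_prop) measurable_snd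
  calc ∫⁻ x in S, ENNReal.ofReal (‖x - y‖ ^ (-p)) ∂ν
      ≤ ∫⁻ x in S, ENNReal.ofReal (2 ^ (p + 1)) * (∫⁻ r in I, f x r) ∂ν := by
        refine setLIntegral_mono' hS fun x hx => ?_
        refine (ofReal_rpow_neg_le_lintegral_Ioo (norm_nonneg _) hp).trans
          (mul_le_mul_right ?_ _)
        refine le_trans (setLIntegral_mono' measurableSet_Ioo fun r hr => ?_)
          (lintegral_mono_set (hSI x hx))
        have : (x, r) ∈ {z : 𝔼 × ℝ | ‖z.1 - y‖ < z.2} := hr.1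
        simp only [f]
        rw [Set.indicator_of_mem this]
    _ = ENNReal.ofReal (2 ^ (p + 1)) * ∫⁻ r in I, ∫⁻ x in S, f x r ∂ν := by
        have hf' : Measurable fun x => ∫⁻ r in I, f x r := hf.lintegral_prod_right'
        -- Tonelli: for fixed `r`, the condition `‖x - y‖ < r` becomes the ball measure.
        rw [lintegral_const_mul _ hf', lintegral_lintegral_swap hf.aemeasurable]
    _ ≤ _ := by
        refine mul_le_mul_right (setLIntegral_mono' hI fun r _ => ?_) _
        refine (setLIntegral_le_lintegral _ _).trans (le_of_eq ?_)
        have : (fun x => f x r) = (Metric.ball y r).indicator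
            fun _ => (ENNReal.ofReal (r ^ (p + 1)))⁻¹ := by
          ext x
          by_cases h : ‖x - y‖ < r <;> simp [f, h, Set.indicator, dist_eq_norm]
        rw [this, lintegral_indicator_const Metric.isOpen_ball.measurableSet, mul_comm,
          div_eq_mul_inv]

theorem measure_ball_le_centeredMorreyNorm (ν : Measure 𝔼) {s r : ℝ} (hr : 0 < r) :
    ν (Metric.ball 0 r) ≤ centeredMorreyNorm ν s * ENNReal.ofReal (r ^ s) := by
  have hr' := Real.rpow_pos_of_pos hr s
  refine (ENNReal.div_le_iff (ENNReal.ofReal_pos.2 hr').ne' ENNReal.ofReal_ne_top).1 ?_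
  exact le_iSup₂ (f := fun (r : ℝ) (_ : 0 < r) =>
    ν (Metric.ball 0 r) / ENNReal.ofReal (r ^ s)) r hr

theorem sigmaFinite_of_centeredMorreyNorm_lt_top {ν : Measure 𝔼} {s : ℝ}
    (hν : centeredMorreyNorm ν s < ⊤) : SigmaFinite ν := by
  refine ⟨⟨⟨fun n : ℕ => Metric.ball 0 (n + 1), fun _ => trivial, fun n => ?_, ?_⟩⟩⟩
  · exact (measure_ball_le_centeredMorreyNorm ν (s := s) (by positivity)).trans_lt
      (ENNReal.mul_lt_top hν ENNReal.ofReal_lt_top)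
  · refine Set.eq_univ_of_forall fun x => Set.mem_iUnion.2 ?_
    obtain ⟨n, hn⟩ := exists_nat_gt ‖x‖
    exact ⟨n, by simpa using hn.trans (lt_add_one _)⟩

/-- Decay at infinity: `∫_{|x| > ρ} |x|^{-(s+q)} dν ≲ ‖ν‖_{0,s} ρ^{-q}`. -/
theorem setLIntegral_norm_rpow_neg_le (ν : Measure 𝔼) [SFinite ν] {s q ρ : ℝ} (hs : 0 < s)
    (hq : 0 < q) (hρ : 0 < ρ) :
    ∫⁻ x in {x : 𝔼 | ρ < ‖x‖}, ENNReal.ofReal (‖x‖ ^ (-(s + q))) ∂ν ≤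
      ENNReal.ofReal (2 ^ (s + q + 1)) *
        (centeredMorreyNorm ν s * ENNReal.ofReal (ρ ^ (-q) / q)) := by
  have h := setLIntegral_rpow_neg_le ν 0 (p := s + q) (by positivity)
    (measurableSet_lt measurable_const measurable_norm : MeasurableSet {x : 𝔼 | ρ < ‖x‖})
    measurableSet_Ioi (I := Set.Ioi ρ) fun x hx r hr => by
      simp only [sub_zero] at hr
      exact lt_trans hx hr.1
  simp only [sub_zero] at h
  refine h.trans (mul_le_mul_right ?_ _)
  have hint : IntegrableOn (fun r : ℝ => r ^ (-q - 1)) (Set.Ioi ρ) :=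
    integrableOn_Ioi_rpow_of_lt (by linarith) hρ
  calc ∫⁻ r in Set.Ioi ρ, ν (Metric.ball 0 r) / ENNReal.ofReal (r ^ (s + q + 1))
      ≤ ∫⁻ r in Set.Ioi ρ, centeredMorreyNorm ν s * ENNReal.ofReal (r ^ (-q - 1)) := by
        refine setLIntegral_mono' measurableSet_Ioi fun r hr => ?_
        have hr : 0 < r := hρ.trans hr
        refine (ENNReal.div_le_div_right (measure_ball_le_centeredMorreyNorm ν (s := s) hr) _).trans
          (le_of_eq ?_)
        rw [mul_div_assoc, ← ENNReal.ofReal_div_of_pos (Real.rpow_pos_of_pos hr _),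
          ← Real.rpow_sub hr]
        ring_nf
    _ = centeredMorreyNorm ν s * ∫⁻ r in Set.Ioi ρ, ENNReal.ofReal (r ^ (-q - 1)) :=
        lintegral_const_mul _ (by fun_prop)
    _ = _ := by
        rw [← ofReal_integral_eq_lintegral_ofReal hint, integral_Ioi_rpow_of_lt (by linarith) hρ]
        · congr 2
          rw [sub_add_cancel, neg_div_neg_eq]
        · filter_upwards [ae_restrict_mem measurableSet_Ioi] with r hr
          exact Real.rpow_nonneg (hρ.trans hr).le _

/-- The radius `|y|/4` is chosen so that the doubled radii stay below `|y|/2`, the cutoff in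
`uniformPotential`. -/
theorem setLIntegral_near_rpow_neg_le (ν : Measure 𝔼) [SFinite ν] {s : ℝ} (hs : 0 < s) (y : 𝔼) :
    ∫⁻ x in {x : 𝔼 | ‖x - y‖ < ‖y‖ / 4}, ENNReal.ofReal (‖x - y‖ ^ (-s)) ∂ν ≤
      ENNReal.ofReal (2 ^ (s + 1)) * uniformPotential ν s := by
  refine (setLIntegral_rpow_neg_le ν y hs (measurableSet_lt (by fun_prop) measurable_const)
    measurableSet_Ioo (I := Set.Ioo 0 (‖y‖ / 2)) fun x hx r hr => ?_).trans (mul_le_mul_right ?_ _)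
  · have hx : ‖x - y‖ < ‖y‖ / 4 := hx
    exact ⟨(norm_nonneg _).trans_lt hr.1, hr.2.trans (by linarith)⟩
  · exact le_iSup (fun y : 𝔼 => ∫⁻ r in Set.Ioo (0 : ℝ) (‖y‖ / 2),
      ν (Metric.ball y r) / ENNReal.ofReal (r ^ (s + 1))) y

/-! ### The dominating kernel and its `L¹` to `L^q(ν)` bound. -/

/-- The kernel dominating `K` on vector fields annihilated by a cocanceling operator. -/
noncomputable def steinWeissKernel (a : ℝ) (x y : 𝔼) : ℝ :=
  if 4 * ‖y‖ < ‖x‖ then ‖y‖ * ‖x‖ ^ (-(a + 1)) else ‖x - y‖ ^ (-a)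

theorem steinWeissKernel_nonneg (a : ℝ) (x y : 𝔼) : 0 ≤ steinWeissKernel a x y := by
  unfold steinWeissKernel
  split_ifs <;> positivity

theorem measurable_steinWeissKernel (a : ℝ) :
    Measurable (Function.uncurry (steinWeissKernel (N := N) a)) := by
  unfold steinWeissKernel Function.uncurry
  exact Measurable.ite (measurableSet_lt (by fun_prop) (by fun_prop)) (by fun_prop) (by fun_prop)

theorem rpow_rpow_neg {t a q : ℝ} (ht : 0 ≤ t) : (t ^ (-a)) ^ q = t ^ (-(a * q)) := by
  rw [← Real.rpow_mul ht, neg_mul]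

/-- Three regions, each scale invariant in `|y|`. For `|x| > 4|y|` the extra decay beats the Morrey
growth of `ν`; for `|x-y| < |y|/4` the potential applies; on the rest the kernel is bounded and the
region lies in `B(0,5|y|)`, giving `(5|y|)^s (|y|/4)^{-s} = 20^s`. -/
theorem exists_lintegral_steinWeissKernel_rpow_le (ν : Measure 𝔼) {a q : ℝ} (ha : 0 < a)
    (hq : 0 < q) (hν : centeredMorreyNorm ν (a * q) < ⊤) (hν' : uniformPotential ν (a * q) < ⊤) :
    ∃ M : ℝ≥0∞, M < ⊤ ∧
      ∀ y, ∫⁻ x, ENNReal.ofReal (steinWeissKernel a x y) ^ q ∂ν ≤ M := by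
  have := sigmaFinite_of_centeredMorreyNorm_lt_top hν
  have hs : 0 < a * q := mul_pos ha hq
  set s := a * q
  set A := centeredMorreyNorm ν s
  refine ⟨ENNReal.ofReal (2 ^ (s + q + 1)) * (A * ENNReal.ofReal (4 ^ (-q) / q)) +
    (ENNReal.ofReal (2 ^ (s + 1)) * uniformPotential ν s + A * ENNReal.ofReal (20 ^ s)), ?_, ?_⟩
  · simp only [ENNReal.add_lt_top]
    exact ⟨ENNReal.mul_lt_top ENNReal.ofReal_lt_top (ENNReal.mul_lt_top hν ENNReal.ofReal_lt_top),
      ENNReal.mul_lt_top ENNReal.ofReal_lt_top hν', ENNReal.mul_lt_top hν ENNReal.ofReal_lt_top⟩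
  intro y
  have hpow : ∀ x, ENNReal.ofReal (steinWeissKernel a x y) ^ q =
      ENNReal.ofReal (steinWeissKernel a x y ^ q) := fun x =>
    ENNReal.ofReal_rpow_of_nonneg (steinWeissKernel_nonneg _ _ _) hq.le
  simp only [hpow]
  rcases eq_or_ne y 0 with rfl | hy
  · have : ∀ x : 𝔼, steinWeissKernel a x 0 = 0 := fun x => by
      rcases eq_or_ne x 0 with rfl | hx
      · simp [steinWeissKernel, Real.zero_rpow (neg_ne_zero.2 ha.ne')]
      · simp [steinWeissKernel, hx]
    simp [this, Real.zero_rpow hq.ne']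
  have hy' : 0 < ‖y‖ := norm_pos_iff.2 hy
  let S₁ : Set 𝔼 := {x | 4 * ‖y‖ < ‖x‖}
  let S₂ : Set 𝔼 := {x | ‖x - y‖ < ‖y‖ / 4}
  let S₃ : Set 𝔼 := {x | ‖x‖ ≤ 4 * ‖y‖} ∩ {x | ‖y‖ / 4 ≤ ‖x - y‖}
  have hS₁ : MeasurableSet S₁ := measurableSet_lt measurable_const measurable_norm
  have hS₂ : MeasurableSet S₂ := measurableSet_lt (by fun_prop) measurable_const
  have hS₃ : MeasurableSet S₃ := (measurableSet_le measurable_norm measurable_const).inter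
    (measurableSet_le measurable_const (by fun_prop))
  have huniv : S₁ ∪ (S₂ ∪ S₃) = Set.univ := Set.eq_univ_of_forall fun x => by
    by_cases h1 : 4 * ‖y‖ < ‖x‖
    · exact Or.inl h1
    · by_cases h2 : ‖x - y‖ < ‖y‖ / 4
      · exact Or.inr (Or.inl h2)
      · exact Or.inr (Or.inr ⟨not_lt.1 h1, not_lt.1 h2⟩)
  rw [← setLIntegral_univ, ← huniv]
  refine (lintegral_union_le _ _ _).trans (add_le_add ?_
    ((lintegral_union_le _ _ _).trans (add_le_add ?_ ?_)))
  · calc ∫⁻ x in S₁, ENNReal.ofReal (steinWeissKernel a x y ^ q) ∂ν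
        = ∫⁻ x in S₁, ENNReal.ofReal (‖y‖ ^ q) * ENNReal.ofReal (‖x‖ ^ (-(s + q))) ∂ν := by
          refine setLIntegral_congr_fun hS₁ fun x hx => ?_
          have hx : 4 * ‖y‖ < ‖x‖ := hx
          simp only [steinWeissKernel, if_pos hx]
          rw [Real.mul_rpow hy'.le (by positivity), rpow_rpow_neg (norm_nonneg _),
            ENNReal.ofReal_mul (by positivity)]
          simp only [s]
          ring_nf
      _ = ENNReal.ofReal (‖y‖ ^ q) * ∫⁻ x in S₁, ENNReal.ofReal (‖x‖ ^ (-(s + q))) ∂ν :=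
          lintegral_const_mul _ (by fun_prop)
      _ ≤ ENNReal.ofReal (‖y‖ ^ q) * (ENNReal.ofReal (2 ^ (s + q + 1)) *
            (A * ENNReal.ofReal ((4 * ‖y‖) ^ (-q) / q))) :=
          mul_le_mul_right (setLIntegral_norm_rpow_neg_le ν hs hq (by positivity)) _
      _ = ENNReal.ofReal (2 ^ (s + q + 1)) *
            (A * (ENNReal.ofReal (‖y‖ ^ q) * ENNReal.ofReal ((4 * ‖y‖) ^ (-q) / q))) := by ring
      _ = _ := by
          rw [← ENNReal.ofReal_mul (by positivity), Real.mul_rpow (by norm_num) hy'.le,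
            Real.rpow_neg hy'.le]
          have := Real.rpow_pos_of_pos hy' q
          congr 3
          field_simp
  · refine le_trans (le_of_eq (setLIntegral_congr_fun hS₂ fun x hx => ?_))
      (setLIntegral_near_rpow_neg_le ν hs y)
    have hx : ‖x - y‖ < ‖y‖ / 4 := hx
    have hx' : ¬4 * ‖y‖ < ‖x‖ := by
      have := norm_le_norm_add_norm_sub' x y
      linarith
    simp only [steinWeissKernel, if_neg hx']
    rw [rpow_rpow_neg (norm_nonneg _)]
  · calc ∫⁻ x in S₃, ENNReal.ofReal (steinWeissKernel a x y ^ q) ∂ν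
        ≤ ∫⁻ _ in S₃, ENNReal.ofReal ((‖y‖ / 4) ^ (-s)) ∂ν := by
          refine setLIntegral_mono' hS₃ fun x hx => ENNReal.ofReal_le_ofReal ?_
          have hx1 : ¬4 * ‖y‖ < ‖x‖ := not_lt.2 hx.1
          have hx2 : ‖y‖ / 4 ≤ ‖x - y‖ := hx.2
          simp only [steinWeissKernel, if_neg hx1]
          rw [rpow_rpow_neg (norm_nonneg _)]
          exact Real.rpow_le_rpow_of_nonpos (by positivity) hx2 (by linarith)
      _ = ENNReal.ofReal ((‖y‖ / 4) ^ (-s)) * ν S₃ := setLIntegral_const _ _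
      _ ≤ ENNReal.ofReal ((‖y‖ / 4) ^ (-s)) * (A * ENNReal.ofReal ((5 * ‖y‖) ^ s)) := by
          refine mul_le_mul_right (le_trans (measure_mono fun x hx => ?_)
            (measure_ball_le_centeredMorreyNorm ν (by positivity))) _
          have hx1 : ‖x‖ ≤ 4 * ‖y‖ := hx.1
          simp only [mem_ball_zero_iff]
          linarith
      _ = A * (ENNReal.ofReal ((‖y‖ / 4) ^ (-s)) * ENNReal.ofReal ((5 * ‖y‖) ^ s)) := by ring
      _ = _ := by
          rw [← ENNReal.ofReal_mul (by positivity), Real.rpow_neg (by positivity),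
            inv_mul_eq_div, ← Real.div_rpow (by positivity) (by positivity)]
          congr 3
          field_simp
          norm_num

/-- A uniform `L^q` bound on the slices of a kernel bounds the integral operator from `L¹` to
`L^q`. -/
theorem lintegral_rpow_lintegral_le {X Y : Type*} [MeasurableSpace X] [MeasurableSpace Y]
    (ν : Measure X) (μ : Measure Y) [SFinite ν] [SFinite μ] {k : X → Y → ℝ≥0∞}
    (hk : Measurable (Function.uncurry k)) {q : ℝ} (hq : 1 ≤ q) {M : ℝ≥0∞}
    (hM : ∀ y, ∫⁻ x, k x y ^ q ∂ν ≤ M) :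
    ∫⁻ x, (∫⁻ y, k x y ∂μ) ^ q ∂ν ≤ M * μ Set.univ ^ q := by
  have hq0 : 0 < q := by linarith
  have hkq : Measurable (Function.uncurry fun x y => k x y ^ q) := hk.pow_const q
  -- Hölder in `y` against the constant function `1`.
  have h1 : ∀ x, (∫⁻ y, k x y ∂μ) ^ q ≤ (∫⁻ y, k x y ^ q ∂μ) * μ Set.univ ^ (q - 1) := by
    intro x
    have h := eLpNorm'_le_eLpNorm'_mul_rpow_measure_univ (f := k x) (μ := μ) one_pos hq
      (hk.of_uncurry_left.aestronglyMeasurable)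
    simp only [eLpNorm', enorm_eq_self, ENNReal.rpow_one, div_one] at h
    refine (ENNReal.rpow_le_rpow h hq0.le).trans (le_of_eq ?_)
    rw [ENNReal.mul_rpow_of_nonneg _ _ hq0.le, ← ENNReal.rpow_mul, ← ENNReal.rpow_mul,
      one_div_mul_cancel hq0.ne', ENNReal.rpow_one, sub_mul, one_mul, one_div_mul_cancel hq0.ne']
  calc ∫⁻ x, (∫⁻ y, k x y ∂μ) ^ q ∂ν
      ≤ ∫⁻ x, (∫⁻ y, k x y ^ q ∂μ) * μ Set.univ ^ (q - 1) ∂ν := lintegral_mono h1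
    _ = (∫⁻ y, ∫⁻ x, k x y ^ q ∂ν ∂μ) * μ Set.univ ^ (q - 1) := by
        have hkq' : Measurable fun x => ∫⁻ y, k x y ^ q ∂μ := hkq.lintegral_prod_right'
        rw [lintegral_mul_const _ hkq', lintegral_lintegral_swap hkq.aemeasurable]
    _ ≤ (∫⁻ _, M ∂μ) * μ Set.univ ^ (q - 1) := mul_le_mul_left (lintegral_mono hM) _
    _ = M * (μ Set.univ ^ (1 : ℝ) * μ Set.univ ^ (q - 1)) := by
        rw [lintegral_const, ENNReal.rpow_one, mul_assoc]
    _ = _ := by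
        rw [← ENNReal.rpow_add_of_nonneg _ _ zero_le_one (by linarith), add_sub_cancel]

end Potential

/-! ### Pointwise domination of the integral operator. -/

section PointwiseBound

variable {N : ℕ} {F W : Type*} [NormedAddCommGroup F] [NormedSpace ℂ F]
  [NormedAddCommGroup W] [NormedSpace ℂ W]

local notation "𝔼" => EuclideanSpace ℝ (Fin N)

/-- For `|y| < |x|/4` the size bound on `k` is at most a constant depending on `x`, harmless against
integrable `g`; elsewhere it is `steinWeissKernel` itself. -/
theorem integrable_kernel_apply [NeZero N] {a C : ℝ} (ha : 0 < a) (hC : 0 ≤ C) (x : 𝔼)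
    {k : 𝔼 → F →L[ℂ] W} (hk : AEStronglyMeasurable k volume)
    (hk1 : ∀ y, x ≠ y → ‖k y‖ ≤ C * ‖x - y‖ ^ (-a))
    {g : 𝔼 → F} (hg : Integrable g volume)
    (hgH : Integrable (fun y => steinWeissKernel a x y * ‖g y‖) volume) :
    Integrable (fun y => k y (g y)) volume := by
  refine Integrable.mono' (((hg.norm.const_mul ((‖x‖ / 2) ^ (-a))).add hgH).const_mul C)
    ((ContinuousLinearMap.id ℂ (F →L[ℂ] W)).aestronglyMeasurable_comp₂ hk
      hg.aestronglyMeasurable) ?_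
  filter_upwards [Measure.ae_ne volume x] with y hy
  refine ((k y).le_opNorm _).trans ?_
  have hH := steinWeissKernel_nonneg a x y
  have h0 : 0 ≤ (‖x‖ / 2) ^ (-a) := by positivity
  have h : ‖x - y‖ ^ (-a) ≤ (‖x‖ / 2) ^ (-a) + steinWeissKernel a x y := by
    by_cases hxy : 4 * ‖y‖ < ‖x‖
    · have h1 := norm_sub_norm_le x y
      have h2 := norm_nonneg y
      have h3 : ‖x - y‖ ^ (-a) ≤ (‖x‖ / 2) ^ (-a) :=
        Real.rpow_le_rpow_of_nonpos (by linarith) (by linarith) (by linarith)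
      linarith
    · simp only [steinWeissKernel, if_neg hxy]
      linarith
  calc ‖k y‖ * ‖g y‖ ≤ C * ‖x - y‖ ^ (-a) * ‖g y‖ :=
        mul_le_mul_of_nonneg_right (hk1 y hy.symm) (norm_nonneg _)
    _ ≤ C * ((‖x‖ / 2) ^ (-a) + steinWeissKernel a x y) * ‖g y‖ := by gcongr
    _ = _ := by
        simp only [Pi.add_apply]
        ring

/-- In the constant, `1` collects the difference `k y - k 0` on the inner ball and the size bound
outside it; `M * 2 ^ a` comes from the frozen term `k 0`. -/
theorem norm_integral_kernel_apply_le [NeZero N] [FiniteDimensional ℂ F] [FiniteDimensional ℂ W]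
    {a C M : ℝ} (ha : 0 < a) (hC : 0 ≤ C)
    (hM : 0 ≤ M) (x : 𝔼) {k : 𝔼 → F →L[ℂ] W} (hk : AEStronglyMeasurable k volume)
    (hk1 : ∀ y, x ≠ y → ‖k y‖ ≤ C * ‖x - y‖ ^ (-a))
    (hk2 : ∀ y, 2 * ‖y‖ ≤ ‖x‖ → ‖k y - k 0‖ ≤ C * (‖y‖ / ‖x‖ ^ (a + 1)))
    {g : 𝔼 → F} (hg : Integrable g volume)
    (hgM : ∀ R : ℝ, 0 < R →
      ‖∫ y in Metric.ball 0 (R / 4), g y‖ ≤ M * ∫ y in annulus N R, ‖g y‖)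
    (hgH : Integrable (fun y => steinWeissKernel a x y * ‖g y‖) volume) :
    ‖∫ y, k y (g y)‖ ≤ C * (1 + M * 2 ^ a) * ∫ y, steinWeissKernel a x y * ‖g y‖ := by
  have : CompleteSpace F := FiniteDimensional.complete ℂ F
  have : CompleteSpace W := FiniteDimensional.complete ℂ W
  have hint := integrable_kernel_apply ha hC x hk hk1 hg hgH
  have hH := steinWeissKernel_nonneg a x
  have hfar : ∀ y, y ≠ x → ¬4 * ‖y‖ < ‖x‖ →
      ‖k y (g y)‖ ≤ C * (steinWeissKernel a x y * ‖g y‖) := fun y hy hxy => by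
    refine ((k y).le_opNorm _).trans ?_
    rw [← mul_assoc]
    refine mul_le_mul_of_nonneg_right ?_ (norm_nonneg _)
    simp only [steinWeissKernel, if_neg hxy]
    exact hk1 y hy.symm
  have hI0 : 0 ≤ ∫ y, steinWeissKernel a x y * ‖g y‖ :=
    integral_nonneg fun y => mul_nonneg (hH y) (norm_nonneg _)
  rcases eq_or_ne x 0 with rfl | hx
  · have h1 : ‖∫ y, k y (g y)‖ ≤ ∫ y, C * (steinWeissKernel a 0 y * ‖g y‖) := by
      refine norm_integral_le_of_norm_le (hgH.const_mul C) ?_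
      filter_upwards [Measure.ae_ne volume (0 : 𝔼)] with y hy
      exact hfar y hy (by simp)
    rw [integral_const_mul] at h1
    refine h1.trans (mul_le_mul_of_nonneg_right ?_ hI0)
    have : 0 ≤ M * 2 ^ a := by positivity
    nlinarith
  have hx0 : 0 < ‖x‖ := norm_pos_iff.2 hx
  set B : Set 𝔼 := Metric.ball 0 (‖x‖ / 4)
  have hB : MeasurableSet B := Metric.isOpen_ball.measurableSet
  have hBmem : ∀ y, y ∈ B ↔ 4 * ‖y‖ < ‖x‖ := fun y => by
    rw [mem_ball_zero_iff, lt_div_iff₀ (by norm_num), mul_comm]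
  have hnear : ‖∫ y in B, (k y (g y) - k 0 (g y))‖ ≤
      ∫ y in B, C * (steinWeissKernel a x y * ‖g y‖) := by
    refine norm_integral_le_of_norm_le (hgH.const_mul C).integrableOn ?_
    filter_upwards [ae_restrict_mem hB] with y hy
    rw [hBmem] at hy
    rw [← sub_apply]
    refine ((k y - k 0).le_opNorm _).trans ?_
    rw [← mul_assoc]
    refine mul_le_mul_of_nonneg_right ?_ (norm_nonneg _)
    simp only [steinWeissKernel, if_pos hy]
    rw [Real.rpow_neg hx0.le, ← div_eq_mul_inv]
    exact hk2 y (by linarith [norm_nonneg y])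
  have hcompl : ‖∫ y in Bᶜ, k y (g y)‖ ≤ ∫ y in Bᶜ, C * (steinWeissKernel a x y * ‖g y‖) := by
    refine norm_integral_le_of_norm_le (hgH.const_mul C).integrableOn ?_
    filter_upwards [ae_restrict_mem hB.compl, ae_restrict_of_ae (Measure.ae_ne volume x)]
      with y hy hyx
    exact hfar y hyx fun h => hy ((hBmem y).2 h)
  -- The annulus lies in the singular branch `|y| ≥ |x|/4`, and there `|x-y| ≤ 2|x|`.
  have hann : ‖x‖ ^ (-a) * ∫ y in annulus N ‖x‖, ‖g y‖ ≤
      2 ^ a * ∫ y, steinWeissKernel a x y * ‖g y‖ := by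
    rw [← integral_const_mul, ← integral_const_mul]
    refine (setIntegral_mono_on (hg.norm.const_mul _).integrableOn (hgH.const_mul _).integrableOn
      (measurableSet_annulus _) fun y hy => ?_).trans (setIntegral_le_integral (hgH.const_mul _)
        (Filter.Eventually.of_forall fun y => mul_nonneg (by positivity)
          (mul_nonneg (hH y) (norm_nonneg _))))
    rw [← mul_assoc]
    refine mul_le_mul_of_nonneg_right ?_ (norm_nonneg _)
    obtain ⟨hy1, hy2⟩ := hy
    have hxy : ¬4 * ‖y‖ < ‖x‖ := by linarith
    simp only [steinWeissKernel, if_neg hxy]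
    have h1 := norm_sub_norm_le x y
    have h2 := norm_sub_le x y
    have h3 : (2 * ‖x‖) ^ (-a) ≤ ‖x - y‖ ^ (-a) :=
      Real.rpow_le_rpow_of_nonpos (by linarith) (by linarith) (by linarith)
    rw [Real.mul_rpow two_pos.le hx0.le, Real.rpow_neg two_pos.le] at h3
    rwa [inv_mul_le_iff₀ (by positivity)] at h3
  have hmid : ‖k 0 (∫ y in B, g y)‖ ≤
      C * (M * (2 ^ a * ∫ y, steinWeissKernel a x y * ‖g y‖)) := by
    have hk0 : ‖k 0‖ ≤ C * ‖x‖ ^ (-a) := by simpa using hk1 0 hx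
    calc ‖k 0 (∫ y in B, g y)‖ ≤ ‖k 0‖ * ‖∫ y in B, g y‖ := (k 0).le_opNorm _
      _ ≤ C * ‖x‖ ^ (-a) * (M * ∫ y in annulus N ‖x‖, ‖g y‖) :=
          mul_le_mul hk0 (hgM _ hx0) (norm_nonneg _) (by positivity)
      _ = C * (M * (‖x‖ ^ (-a) * ∫ y in annulus N ‖x‖, ‖g y‖)) := by ring
      _ ≤ _ := by gcongr
  have hk0g : Integrable (fun y => k 0 (g y)) volume := (k 0).integrable_comp hg
  have hsplit : ∫ y, k y (g y) = (∫ y in B, (k y (g y) - k 0 (g y))) + k 0 (∫ y in B, g y) +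
      ∫ y in Bᶜ, k y (g y) := by
    rw [← integral_add_compl hB hint, integral_sub hint.integrableOn hk0g.integrableOn,
      (k 0).integral_comp_comm hg.integrableOn, sub_add_cancel]
  have hadd : (∫ y in B, C * (steinWeissKernel a x y * ‖g y‖)) +
      ∫ y in Bᶜ, C * (steinWeissKernel a x y * ‖g y‖) =
        C * ∫ y, steinWeissKernel a x y * ‖g y‖ := by
    rw [integral_add_compl hB (hgH.const_mul C), integral_const_mul]
  rw [hsplit]
  refine (norm_add₃_le).trans ?_
  linarith

end PointwiseBound

/-! ### Assembly of the estimate. -/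

theorem mainTheorem3 {N κ : ℕ} (hN : 2 ≤ N)
    {F V W : Type*}
    [NormedAddCommGroup F] [NormedSpace ℂ F] [FiniteDimensional ℂ F]
    [NormedAddCommGroup V] [NormedSpace ℂ V] [FiniteDimensional ℂ V]
    [NormedAddCommGroup W] [NormedSpace ℂ W] [FiniteDimensional ℂ W]
    (ℓ q : ℝ) (hℓ0 : 0 < ℓ) (hℓN : ℓ < N) (hq : 1 ≤ q)
    (ν : Measure (EuclideanSpace ℝ (Fin N)))
    (hν : centeredMorreyNorm ν ((N - ℓ) * q) < ⊤)
    (hν' : uniformPotential ν ((N - ℓ) * q) < ⊤)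
    (K : EuclideanSpace ℝ (Fin N) → EuclideanSpace ℝ (Fin N) → F →L[ℂ] W)
    (hK : LocallyIntegrable (Function.uncurry K) (volume.prod volume))
    (hKν : AEStronglyMeasurable (Function.uncurry K) (ν.prod volume))
    (C : ℝ)
    (hK1 : ∀ x y, x ≠ y → ‖K x y‖ ≤ C * ‖x - y‖ ^ (ℓ - N))
    (hK2 : ∀ x y, 2 * ‖y‖ ≤ ‖x‖ → ‖K x y - K x 0‖ ≤ C * (‖y‖ / ‖x‖ ^ (N - ℓ + 1)))
    (L : HomDiffOp N κ F V) (hL : L.Cocanceling) :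
    ∃ Ct : ℝ, 0 < Ct ∧ ∀ g : EuclideanSpace ℝ (Fin N) → F, Integrable g volume →
      L.DistribKer g →
        (∀ᵐ x ∂ν, Integrable (fun y => K x y (g y)) volume) ∧
        AEStronglyMeasurable (fun x => ∫ y, K x y (g y)) ν ∧
        (∫⁻ x, ‖∫ y, K x y (g y)‖ₑ ^ q ∂ν) ^ (1 / q)
          ≤ ENNReal.ofReal (Ct * ∫ x, ‖g x‖) := by
  have : NeZero N := ⟨by omega⟩
  have := sigmaFinite_of_centeredMorreyNorm_lt_top hν
  have hq0 : 0 < q := by linarith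
  have ha : 0 < N - ℓ := by linarith
  obtain ⟨M, hM, hgM⟩ := hL.norm_integral_ball_le
  obtain ⟨A, hA, hHA⟩ := exists_lintegral_steinWeissKernel_rpow_le ν ha hq0 hν hν'
  set a := N - ℓ
  have hk1 : ∀ x y, x ≠ y → ‖K x y‖ ≤ |C| * ‖x - y‖ ^ (-a) := fun x y hxy => by
    refine (hK1 x y hxy).trans ?_
    rw [show ℓ - N = -a from (neg_sub _ _).symm]
    exact mul_le_mul_of_nonneg_right (le_abs_self C) (by positivity)
  have hk2 : ∀ x y, 2 * ‖y‖ ≤ ‖x‖ → ‖K x y - K x 0‖ ≤ |C| * (‖y‖ / ‖x‖ ^ (a + 1)) :=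
    fun x y hxy => (hK2 x y hxy).trans
      (mul_le_mul_of_nonneg_right (le_abs_self C) (by positivity))
  set C₁ := |C| * (1 + M * 2 ^ a)
  have hC₁ : 0 ≤ C₁ := by positivity
  have hAr : A ^ (1 / q) ≠ ⊤ := (ENNReal.rpow_lt_top_of_nonneg (by positivity) hA.ne).ne
  refine ⟨C₁ * (A ^ (1 / q)).toReal + 1, by positivity, fun g hg hLg => ?_⟩
  -- Absorbing `‖g‖` into the measure makes the total mass of `μ` the `L¹` norm of `g`.
  set μ : Measure (EuclideanSpace ℝ (Fin N)) := volume.withDensity fun y => ‖g y‖ₑ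
  have hHm := (measurable_steinWeissKernel (N := N) a)
  have hμ : μ Set.univ = ENNReal.ofReal (∫ y, ‖g y‖) := by
    rw [withDensity_apply _ MeasurableSet.univ, setLIntegral_univ,
      ofReal_integral_norm_eq_lintegral_enorm hg]
  have hJ : ∫⁻ x, (∫⁻ y, ENNReal.ofReal (steinWeissKernel a x y) ∂μ) ^ q ∂ν ≤
      A * μ Set.univ ^ q :=
    lintegral_rpow_lintegral_le ν μ (k := fun x y => ENNReal.ofReal (steinWeissKernel a x y))
      hHm.ennreal_ofReal hq hHA
  have hJeq : ∀ x, ∫⁻ y, ENNReal.ofReal (steinWeissKernel a x y) ∂μ =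
      ∫⁻ y, ENNReal.ofReal (steinWeissKernel a x y * ‖g y‖) := fun x => by
    rw [lintegral_withDensity_eq_lintegral_mul₀ hg.aestronglyMeasurable.enorm
      hHm.of_uncurry_left.ennreal_ofReal.aemeasurable]
    refine lintegral_congr fun y => ?_
    rw [Pi.mul_apply, ENNReal.ofReal_mul (steinWeissKernel_nonneg _ _ _), ofReal_norm, mul_comm]
  simp only [hJeq] at hJ
  have hJm : Measurable fun x => ∫⁻ y, ENNReal.ofReal (steinWeissKernel a x y * ‖g y‖) := by
    simp only [← hJeq]
    exact hHm.ennreal_ofReal.lintegral_prod_right'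
  -- The `L^q(ν)` bound forces the dominating integral to be finite `ν`-almost everywhere.
  have hgH : ∀ᵐ x ∂ν, Integrable (fun y => steinWeissKernel a x y * ‖g y‖) volume := by
    have hfin : A * μ Set.univ ^ q < ⊤ := ENNReal.mul_lt_top hA
      (ENNReal.rpow_lt_top_of_nonneg hq0.le (hμ ▸ ENNReal.ofReal_ne_top))
    filter_upwards [ae_lt_top (hJm.pow_const q) (hJ.trans_lt hfin).ne] with x hx
    refine ⟨hHm.of_uncurry_left.aestronglyMeasurable.mul hg.aestronglyMeasurable.norm, ?_⟩
    rw [hasFiniteIntegral_iff_ofReal (Filter.Eventually.of_forall fun y =>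
      mul_nonneg (steinWeissKernel_nonneg _ _ _) (norm_nonneg _))]
    exact (ENNReal.rpow_lt_top_iff_of_pos hq0).1 hx
  have hKx : ∀ᵐ x ∂ν, AEStronglyMeasurable (K x) volume := hKν.prodMk_left
  refine ⟨?_, ?_, ?_⟩
  · filter_upwards [hgH, hKx] with x hx hKx
    exact integrable_kernel_apply ha (abs_nonneg C) x hKx (hk1 x) hg hx
  · exact ((ContinuousLinearMap.id ℂ (F →L[ℂ] W)).aestronglyMeasurable_comp₂ hKν
      hg.aestronglyMeasurable.comp_snd).integral_prod_right'
  · have hpt : ∀ᵐ x ∂ν, ‖∫ y, K x y (g y)‖ₑ ^ q ≤ ENNReal.ofReal C₁ ^ q *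
        (∫⁻ y, ENNReal.ofReal (steinWeissKernel a x y * ‖g y‖)) ^ q := by
      filter_upwards [hgH, hKx] with x hx hKx
      rw [← ENNReal.mul_rpow_of_nonneg _ _ hq0.le]
      refine ENNReal.rpow_le_rpow ?_ hq0.le
      rw [← ofReal_integral_eq_lintegral_ofReal hx (Filter.Eventually.of_forall fun y =>
        mul_nonneg (steinWeissKernel_nonneg _ _ _) (norm_nonneg _)), ← ENNReal.ofReal_mul hC₁,
        ← ofReal_norm]
      exact ENNReal.ofReal_le_ofReal (norm_integral_kernel_apply_le ha (abs_nonneg C) hM x hKx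
        (hk1 x) (hk2 x) hg (hgM g hg hLg) hx)
    have hg0 : 0 ≤ ∫ y, ‖g y‖ := integral_nonneg fun y => norm_nonneg _
    calc (∫⁻ x, ‖∫ y, K x y (g y)‖ₑ ^ q ∂ν) ^ (1 / q)
        ≤ (ENNReal.ofReal C₁ ^ q * (A * μ Set.univ ^ q)) ^ (1 / q) := by
          refine ENNReal.rpow_le_rpow ((lintegral_mono_ae hpt).trans ?_) (by positivity)
          rw [lintegral_const_mul _ (hJm.pow_const q)]
          exact mul_le_mul_right hJ _
      _ = ENNReal.ofReal (C₁ * (A ^ (1 / q)).toReal * ∫ y, ‖g y‖) := by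
          rw [ENNReal.mul_rpow_of_nonneg _ _ (by positivity),
            ENNReal.mul_rpow_of_nonneg _ _ (by positivity), ← ENNReal.rpow_mul,
            ← ENNReal.rpow_mul, mul_one_div_cancel hq0.ne', ENNReal.rpow_one, ENNReal.rpow_one,
            hμ, mul_assoc C₁, ENNReal.ofReal_mul (p := C₁) hC₁,
            ENNReal.ofReal_mul ENNReal.toReal_nonneg, ENNReal.ofReal_toReal hAr]
      _ ≤ _ := ENNReal.ofReal_le_ofReal
          (mul_le_mul_of_nonneg_right (by linarith) hg0)
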